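/- Let $(M^n,g)$ be a smooth Riemannian spin manifold with boundary, with Levi-Civita connection $\nabla$, and let $p$ be a smooth symmetric $2$-tensor on $M$. Let $\mathbb S$ be the hypersurface spinor bundle: the bundle associated with the spin structure and a finite-dimensional complex module of the Clifford algebra of $\mathbb R^{n,1}$ (for instance the irreducible one), with Clifford multiplication by $e^0$ (where $(e^0)^2=1$) and by tangent covectors $e^i$ (where $(e^i)^2=-1$), and with a positive definite Hermitian product $\langle\cdot,\cdot\rangle$ for which $e^0\cdot$ is Hermitian and $e^i\cdot$ is skew-Hermitian. Put $(\phi,\psi)=\langle e^0\cdot\phi,\psi\rangle$, let $\nabla$ also denote the spin connection on $\mathbb S$, and let $$\tilde\nabla_i=\nabla_i-\tfrac12\,p_{ij}\,e^j\cdot e^0\cdot .$$ Along $\partial M$ let $e_n$ be the outward unit normal and let $\{e_\alpha\}_{\alpha<n}$ be an orthonormal basis of the tangent space of $\partial M$. Write $h_{\alpha\beta}=\langle\nabla_{e_\alpha}e_n,e_\beta\rangle$, $H=\sum_\alpha h_{\alpha\alpha}$ and $\operatorname{tr}_{\partial M}p=\sum_\alpha p_{\alpha\alpha}$. Fix $\theta\in[-\frac\pi2,\frac\pi2]$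 and a sign $\pm$, the same throughout, and suppose that the tilted boundary dominant energy condition $$H\pm\cos\theta\,\operatorname{tr}_{\partial M}p\;\ge\;|\sin\theta|\Big(\sum_\alpha p_{\alpha n}^2\Big)^{1/2}\quad\text{on }\partial M$$ holds. Let $\phi$ be a smooth section of $\mathbb S$ with $$\tilde\nabla\phi=0\ \text{ in }M,\qquad Q\phi=\pm\phi\ \text{ and }\ \operatorname{Re}\langle\tilde H\phi,\phi\rangle=0\ \text{ on }\partial M,$$ where $$Q\psi=\cos\theta\,e^0\cdot e^n\cdot\psi+\sqrt{-1}\,\sin\theta\,e^n\cdot\psi,$$ $$\tilde H\psi=(H\pm\cos\theta\,\operatorname{tr}_{\partial M}p)\,\psi\mp\sqrt{-1}\,\sin\theta\,\sum_{\alpha}p_{\alpha n}\,e^\alpha\cdot e^n\cdot e^0\cdot\psi$$ (these are the equations that the spinor obtained in the equality case $E\pm\cos\theta P_n=\sin\theta|\hat P|$ of the spacetime positive mass theorem satisfies). Let $N=\langle\phi,\phi\rangle$ and $X^j=X_j=(e^j\cdot\phi,\phi)$. Then, at every point of $\partial M$ and for all $\alpha,\gamma<n$, with summation over $\beta<n$,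 $$p_{\alpha n}\,N\sin^2\theta=\pm\,p_{\alpha\beta}X^\beta\cos\theta+h_{\alpha\beta}X^\beta=(H\pm\cos\theta\,\operatorname{tr}_{\partial M}p)\,X_\alpha$$ and $$p_{\alpha n}X^\gamma\mp\cos\theta\,p_{\alpha\gamma}N-h_{\alpha\gamma}N=0 .$$ -/

import Mathlib

open Bundle
open scoped Manifold ContDiff

noncomputable section

namespace SpinInitialData

/-! ### Clifford algebra -/

/-- The form `v ↦ -|v|²` on `ℝⁿ`: Clifford multiplication by a unit vector squares to `-1`. -/
def riemForm (n : ℕ) : QuadraticForm ℝ (Fin n → ℝ) :=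
  QuadraticMap.weightedSumSquares ℝ (fun _ : Fin n => (-1 : ℝ))

/-- The form `(t, v) ↦ t² - |v|²` on `ℝ × ℝⁿ`: the unit timelike covector `e⁰ = (1, 0)` squares to
`+1`, spacelike unit covectors square to `-1`. -/
def lorentzForm (n : ℕ) : QuadraticForm ℝ (ℝ × (Fin n → ℝ)) :=
  QuadraticMap.prod QuadraticMap.sq (riemForm n)

/-- The inclusion of the Clifford algebra of Euclidean space in that of Minkowski space. -/
def cliffordIncl (n : ℕ) : CliffordAlgebra (riemForm n) →ₐ[ℝ] CliffordAlgebra (lorentzForm n) :=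
  CliffordAlgebra.map (QuadraticMap.Isometry.inr QuadraticMap.sq (riemForm n))

/-- A complex module over the Clifford algebra of Minkowski space `ℝ^{n,1}`, with a positive
definite Hermitian product for which `e⁰` is Hermitian and spacelike vectors are skew-Hermitian. -/
structure SpinorModule (n : ℕ) (S : Type*) [NormedAddCommGroup S] [InnerProductSpace ℂ S] where
  /-- The Clifford action. -/
  rep : CliffordAlgebra (lorentzForm n) →ₐ[ℝ] Module.End ℂ S
  adjoint_rep : ∀ (t : ℝ) (v : Fin n → ℝ) (φ ψ : S),
    inner ℂ (rep (CliffordAlgebra.ι (lorentzForm n) (t, v)) φ) ψ =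
      inner ℂ φ (rep (CliffordAlgebra.ι (lorentzForm n) (t, -v)) ψ)

namespace SpinorModule

variable {n : ℕ} {S : Type*} [NormedAddCommGroup S] [InnerProductSpace ℂ S]

/-- Clifford multiplication by the unit timelike covector `e⁰`. -/
def time (W : SpinorModule n S) : Module.End ℂ S :=
  W.rep (CliffordAlgebra.ι (lorentzForm n) (1, 0))

/-- Clifford multiplication by a spacelike vector `v ∈ ℝⁿ`. -/
def space (W : SpinorModule n S) (v : Fin n → ℝ) : Module.End ℂ S :=
  W.rep (CliffordAlgebra.ι (lorentzForm n) (0, v))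

/-- The spin representation: the action of `Spin(n)` on the Clifford module. -/
def spinAct (W : SpinorModule n S) (s : spinGroup (riemForm n)) : Module.End ℂ S :=
  W.rep (cliffordIncl n (s : CliffordAlgebra (riemForm n)))

end SpinorModule

/-! ### Geometry of a Riemannian manifold with boundary of dimension `m + 1` -/

section Geometry

variable {m : ℕ} {M : Type*} [TopologicalSpace M] [ChartedSpace (EuclideanHalfSpace (m + 1)) M]
  [IsManifold (𝓡∂ (m + 1)) ∞ M]
  [RiemannianBundle (fun x : M => TangentSpace (𝓡∂ (m + 1)) x)]
  [IsContMDiffRiemannianBundle (𝓡∂ (m + 1)) ∞ (EuclideanSpace ℝ (Fin (m + 1)))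
    (fun x : M => TangentSpace (𝓡∂ (m + 1)) x)]

set_option synthInstance.maxHeartbeats 400000 in
/-- `cov` is the Levi-Civita connection: metric and torsion free. -/
def IsLeviCivita (cov : CovariantDerivative (𝓡∂ (m + 1)) (EuclideanSpace ℝ (Fin (m + 1)))
    (fun x : M => TangentSpace (𝓡∂ (m + 1)) x)) : Prop :=
  cov.IsMetricCompatible ∧ cov.torsion = 0

/-- The derivative of the first chart coordinate at `x`, in direction `v`. The manifold lies where
that coordinate is nonnegative and its boundary where it vanishes: at a boundary point the vectors
tangent to `∂M` are those with value `0`, the outward pointing ones those with negative value. -/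
def inwardComponent (x : M) (v : TangentSpace (𝓡∂ (m + 1)) x) : ℝ :=
  (mvfderiv (𝓡∂ (m + 1)) (extChartAt (𝓡∂ (m + 1)) x) x v : EuclideanSpace ℝ (Fin (m + 1))) 0

/-- `η` is a vector field, smooth near `∂M`, that restricts to the outward unit normal of `∂M`. -/
structure IsOutwardNormal (η : ∀ x : M, TangentSpace (𝓡∂ (m + 1)) x) : Prop where
  smooth : ∀ x ∈ (𝓡∂ (m + 1)).boundary M,
    ContMDiffAt (𝓡∂ (m + 1)) (𝓡∂ (m + 1)).tangent ∞
      (fun y => (⟨y, η y⟩ : TangentBundle (𝓡∂ (m + 1)) M)) x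
  unit : ∀ x ∈ (𝓡∂ (m + 1)).boundary M, inner ℝ (η x) (η x) = (1 : ℝ)
  normal : ∀ x ∈ (𝓡∂ (m + 1)).boundary M, ∀ v : TangentSpace (𝓡∂ (m + 1)) x,
    inwardComponent x v = 0 → inner ℝ (η x) v = (0 : ℝ)
  outward : ∀ x ∈ (𝓡∂ (m + 1)).boundary M, inwardComponent x (η x) < 0

/-- `e` is an orthonormal basis of the tangent space of `∂M` at the boundary point `x`. -/
def IsBoundaryFrame (x : M) (e : Fin m → TangentSpace (𝓡∂ (m + 1)) x) : Prop :=
  Orthonormal ℝ e ∧ ∀ α, inwardComponent x (e α) = 0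

/-- The second fundamental form `h(v, w) = ⟨∇_v η, w⟩` of `∂M` (for `v`, `w` tangent to `∂M`). -/
def boundaryForm (cov : CovariantDerivative (𝓡∂ (m + 1)) (EuclideanSpace ℝ (Fin (m + 1)))
      (fun x : M => TangentSpace (𝓡∂ (m + 1)) x))
    (η : ∀ x : M, TangentSpace (𝓡∂ (m + 1)) x) (x : M)
    (v w : TangentSpace (𝓡∂ (m + 1)) x) : ℝ :=
  inner ℝ (cov η x v) w

/-- The mean curvature `H = ∑ h(e_α, e_α)` of `∂M`, computed in an orthonormal frame of `∂M`. -/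
def meanCurvature (cov : CovariantDerivative (𝓡∂ (m + 1)) (EuclideanSpace ℝ (Fin (m + 1)))
      (fun x : M => TangentSpace (𝓡∂ (m + 1)) x))
    (η : ∀ x : M, TangentSpace (𝓡∂ (m + 1)) x) (x : M)
    (e : Fin m → TangentSpace (𝓡∂ (m + 1)) x) : ℝ :=
  ∑ α, boundaryForm cov η x (e α) (e α)

variable (m M) in
/-- The symmetric 2-tensor `p` of an initial data set `(M, g, p)`. -/
structure DataTensor where
  /-- The bilinear form on each tangent space. -/
  toFun : ∀ x : M, TangentSpace (𝓡∂ (m + 1)) x →L[ℝ] TangentSpace (𝓡∂ (m + 1)) x →L[ℝ] ℝ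
  symm : ∀ x v w, toFun x v w = toFun x w v
  smooth : ContMDiff (𝓡∂ (m + 1)) ((𝓡∂ (m + 1)).prod
      𝓘(ℝ, EuclideanSpace ℝ (Fin (m + 1)) →L[ℝ] EuclideanSpace ℝ (Fin (m + 1)) →L[ℝ] ℝ)) ∞
    (fun x => TotalSpace.mk'
      (EuclideanSpace ℝ (Fin (m + 1)) →L[ℝ] EuclideanSpace ℝ (Fin (m + 1)) →L[ℝ] ℝ) x (toFun x))

/-- The trace `tr_{∂M} p`, computed in an orthonormal frame of `∂M`. -/
def boundaryTrace (p : DataTensor m M) (x : M) (e : Fin m → TangentSpace (𝓡∂ (m + 1)) x) : ℝ :=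
  ∑ α, p.toFun x (e α) (e α)

/-- The tilted boundary dominant energy condition
`H + ε cos θ tr_{∂M} p ≥ |sin θ| |p(η, ·)ᵀ|` on `∂M`. -/
def TiltedBoundaryDEC (cov : CovariantDerivative (𝓡∂ (m + 1)) (EuclideanSpace ℝ (Fin (m + 1)))
      (fun x : M => TangentSpace (𝓡∂ (m + 1)) x))
    (p : DataTensor m M) (η : ∀ x : M, TangentSpace (𝓡∂ (m + 1)) x) (θ ε : ℝ) : Prop :=
  ∀ x ∈ (𝓡∂ (m + 1)).boundary M, ∀ e, IsBoundaryFrame x e →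
    |Real.sin θ| * Real.sqrt (∑ α, p.toFun x (η x) (e α) ^ 2) ≤
      meanCurvature cov η x e + ε * Real.cos θ * boundaryTrace p x e

/-! ### Spin structures and hypersurface spinors -/

variable (m M) in
/-- A spin structure, given by local data: an open cover with smooth orthonormal frames, and
continuous transition functions in `Spin(m + 1)` that satisfy the cocycle condition and lift the
transition functions of the frames. -/
structure SpinStructure (ι : Type*) where
  /-- The open cover. -/
  U : ι → Set M
  isOpen : ∀ a, IsOpen (U a)
  cover : ∀ x, ∃ a, x ∈ U a
  /-- The orthonormal frame over `U a`. -/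
  frame : ι → Fin (m + 1) → ∀ x : M, TangentSpace (𝓡∂ (m + 1)) x
  frame_smooth : ∀ a i, ContMDiffOn (𝓡∂ (m + 1)) (𝓡∂ (m + 1)).tangent ∞
    (fun x => (⟨x, frame a i x⟩ : TangentBundle (𝓡∂ (m + 1)) M)) (U a)
  orthonormal : ∀ a, ∀ x ∈ U a, Orthonormal ℝ (fun i => frame a i x)
  /-- The lifted transition functions over `U a ∩ U b`. -/
  trans : ι → ι → M → spinGroup (riemForm (m + 1))
  trans_continuous : ∀ a b, ∀ f : CliffordAlgebra (riemForm (m + 1)) →ₗ[ℝ] ℝ,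
    ContinuousOn (fun x => f (trans a b x)) (U a ∩ U b)
  cocycle : ∀ a b c, ∀ x ∈ U a ∩ U b ∩ U c, trans a b x * trans b c x = trans a c x
  lift : ∀ a b, ∀ x ∈ U a ∩ U b, ∀ v : TangentSpace (𝓡∂ (m + 1)) x,
    (trans a b x : CliffordAlgebra (riemForm (m + 1))) *
        CliffordAlgebra.ι (riemForm (m + 1)) (fun i => inner ℝ (frame b i x) v) =
      CliffordAlgebra.ι (riemForm (m + 1)) (fun i => inner ℝ (frame a i x) v) *
        (trans a b x : CliffordAlgebra (riemForm (m + 1)))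

variable {ι : Type*} {S : Type*} [NormedAddCommGroup S] [InnerProductSpace ℂ S]

/-- A smooth section of the hypersurface spinor bundle, the bundle with fibre `S` associated with
the spin structure: its representatives in the local frames, related by the spin representation. -/
structure SpinorField (P : SpinStructure m M ι) (W : SpinorModule (m + 1) S) where
  /-- The representative over `U a`. -/
  loc : ι → M → S
  smooth : ∀ a, ContMDiffOn (𝓡∂ (m + 1)) 𝓘(ℝ, S) ∞ (loc a) (P.U a)
  compat : ∀ a b, ∀ x ∈ P.U a ∩ P.U b, loc a x = W.spinAct (P.trans a b x) (loc b x)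

/-- Clifford multiplication by the (dual of the) tangent vector `v`, in the frame over `U a`. -/
def cliffordMul (P : SpinStructure m M ι) (W : SpinorModule (m + 1) S) (a : ι) (x : M)
    (v : TangentSpace (𝓡∂ (m + 1)) x) : Module.End ℂ S :=
  W.space (fun i => inner ℝ (P.frame a i x) v)

/-- The lift of the Levi-Civita connection to spinors, in the frame over `U a`:
`∇_v φ = v(φ) + ¼ ∑ ⟨∇_v e_i, e_j⟩ e^i · e^j · φ`. -/
def spinConnection (cov : CovariantDerivative (𝓡∂ (m + 1)) (EuclideanSpace ℝ (Fin (m + 1)))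
      (fun x : M => TangentSpace (𝓡∂ (m + 1)) x))
    (P : SpinStructure m M ι) (W : SpinorModule (m + 1) S) (φ : SpinorField P W) (a : ι) (x : M)
    (v : TangentSpace (𝓡∂ (m + 1)) x) : S :=
  mvfderiv (𝓡∂ (m + 1)) (φ.loc a) x v +
    (1 / 4 : ℝ) • ∑ i, ∑ j, (inner ℝ (cov (P.frame a i) x v) (P.frame a j x) : ℝ) •
      cliffordMul P W a x (P.frame a i x) (cliffordMul P W a x (P.frame a j x) (φ.loc a x))

/-- The restriction of the spacetime connection, `∇̃_v φ = ∇_v φ - ½ ∑ p(v, e_j) e^j · e⁰ · φ`. -/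
def hypersurfaceConnection
    (cov : CovariantDerivative (𝓡∂ (m + 1)) (EuclideanSpace ℝ (Fin (m + 1)))
      (fun x : M => TangentSpace (𝓡∂ (m + 1)) x))
    (p : DataTensor m M)
    (P : SpinStructure m M ι) (W : SpinorModule (m + 1) S) (φ : SpinorField P W) (a : ι) (x : M)
    (v : TangentSpace (𝓡∂ (m + 1)) x) : S :=
  spinConnection cov P W φ a x v -
    (1 / 2 : ℝ) • ∑ j, p.toFun x v (P.frame a j x) •
      cliffordMul P W a x (P.frame a j x) (W.time (φ.loc a x))

/-- `∇̃φ = 0` on `M`. -/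
def IsParallel (cov : CovariantDerivative (𝓡∂ (m + 1)) (EuclideanSpace ℝ (Fin (m + 1)))
      (fun x : M => TangentSpace (𝓡∂ (m + 1)) x))
    (p : DataTensor m M)
    (P : SpinStructure m M ι) (W : SpinorModule (m + 1) S) (φ : SpinorField P W) : Prop :=
  ∀ a, ∀ x ∈ P.U a, ∀ v : TangentSpace (𝓡∂ (m + 1)) x,
    hypersurfaceConnection cov p P W φ a x v = 0

/-- The chirality operator `Qψ = cos θ e⁰ · eⁿ · ψ + √-1 sin θ eⁿ · ψ`, with `eₙ = η`. -/
def chirality (P : SpinStructure m M ι) (W : SpinorModule (m + 1) S)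
    (η : ∀ x : M, TangentSpace (𝓡∂ (m + 1)) x) (θ : ℝ) (a : ι) (x : M) (ψ : S) : S :=
  Real.cos θ • W.time (cliffordMul P W a x (η x) ψ) +
    (Complex.I * (Real.sin θ : ℂ)) • cliffordMul P W a x (η x) ψ

/-- `Qφ = εφ` on `∂M`. -/
def ChiralBoundary (P : SpinStructure m M ι) (W : SpinorModule (m + 1) S)
    (η : ∀ x : M, TangentSpace (𝓡∂ (m + 1)) x) (θ ε : ℝ) (φ : SpinorField P W) : Prop :=
  ∀ x ∈ (𝓡∂ (m + 1)).boundary M, ∀ a, x ∈ P.U a →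
    chirality P W η θ a x (φ.loc a x) = ε • φ.loc a x

/-- The boundary operator
`H̃ψ = (H + ε cos θ tr_{∂M} p) ψ - ε sin θ √-1 ∑ p(e_α, eₙ) e^α · eⁿ · e⁰ · ψ`. -/
def boundaryOperator (cov : CovariantDerivative (𝓡∂ (m + 1)) (EuclideanSpace ℝ (Fin (m + 1)))
      (fun x : M => TangentSpace (𝓡∂ (m + 1)) x))
    (p : DataTensor m M) (P : SpinStructure m M ι) (W : SpinorModule (m + 1) S)
    (η : ∀ x : M, TangentSpace (𝓡∂ (m + 1)) x) (θ ε : ℝ) (a : ι) (x : M)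
    (e : Fin m → TangentSpace (𝓡∂ (m + 1)) x) (ψ : S) : S :=
  (meanCurvature cov η x e + ε * Real.cos θ * boundaryTrace p x e) • ψ -
    (ε * Real.sin θ) • Complex.I • ∑ α, p.toFun x (e α) (η x) •
      cliffordMul P W a x (e α) (cliffordMul P W a x (η x) (W.time ψ))

/-- `Re ⟨H̃φ, φ⟩ = 0` on `∂M`. -/
def BoundaryConstraint (cov : CovariantDerivative (𝓡∂ (m + 1)) (EuclideanSpace ℝ (Fin (m + 1)))
      (fun x : M => TangentSpace (𝓡∂ (m + 1)) x))
    (p : DataTensor m M) (P : SpinStructure m M ι) (W : SpinorModule (m + 1) S)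
    (η : ∀ x : M, TangentSpace (𝓡∂ (m + 1)) x) (θ ε : ℝ) (φ : SpinorField P W) : Prop :=
  ∀ x ∈ (𝓡∂ (m + 1)).boundary M, ∀ a, x ∈ P.U a → ∀ e, IsBoundaryFrame x e →
    (inner ℂ (φ.loc a x)
      (boundaryOperator cov p P W η θ ε a x e (φ.loc a x))).re = 0

/-- The function `N = ⟨φ, φ⟩`, computed in the frame over `U a`. -/
def lapse {P : SpinStructure m M ι} {W : SpinorModule (m + 1) S} (φ : SpinorField P W) (a : ι)
    (x : M) : ℝ :=
  (inner ℂ (φ.loc a x) (φ.loc a x)).re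

/-- The component `⟨X, v⟩ = (v · φ, φ) = ⟨e⁰ · v · φ, φ⟩` of the vector field `X` along `v`,
computed in the frame over `U a`; `e⁰ · v ·` is Hermitian, so this product is real. -/
def shift {P : SpinStructure m M ι} {W : SpinorModule (m + 1) S} (φ : SpinorField P W) (a : ι)
    (x : M) (v : TangentSpace (𝓡∂ (m + 1)) x) : ℝ :=
  (inner ℂ (φ.loc a x) (W.time (cliffordMul P W a x v (φ.loc a x)))).re

end Geometry

end SpinInitialData

end

noncomputable section

namespace SpinInitialData

/-! ### Functions vanishing on the boundary, differentiated along it. -/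

section BoundaryDerivative

variable {m : ℕ} {M : Type*} [TopologicalSpace M] [ChartedSpace (EuclideanHalfSpace (m + 1)) M]
  [IsManifold (𝓡∂ (m + 1)) ∞ M]

/-! Write `ν` for the outward normal, `T` for multiplication by `e⁰`, `a = cos θ`, `b = sin θ`, `q_α
= p_{αn}`, and `A_{αβ} = h_{αβ} + ε a p_{αβ}`. The condition `Qφ = εφ` holds on all of `∂M`, so it
may be differentiated in tangential directions. Eliminating the derivative of `φ` by `∇̃φ = 0`,
every spin connection term cancels, and what remains is algebraic: `A_α · ν · φ + ε b q_α √-1 T φ =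
0`, with `A_α = ∑ A_{αβ} e_β` (`differentiated_chirality`, `boundary_spinor_equation`).

Chirality also forces `b Re⟨√-1 Tφ, u·ν·φ⟩ = -ε X(u)` for tangential `u` (`mul_re_inner_eq`).
Pairing the equation with `e_γ·ν·φ` therefore gives `A_{αγ} N = q_α X_γ`, and pairing it with `√-1
Tφ` gives `∑ A_{αβ} X_β = q_α N b²` (`pairing_identities`). These are all the claims except the one
involving the trace of `A`.

For that one, the first relation says that `N A` has rank at most one with trace `q · X`. The energy
condition bounds `tr A` below by `|b| |q|`, while chirality bounds the tangential part of `X` by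
`|b| N` (`sum_sq_shift_le`). Together they force equality in Cauchy–Schwarz for `q` and `X`; these
are then parallel, and `X` is an eigenvector of `A` with eigenvalue `tr A` (`sum_mul_eq_trace_mul`).
-/

theorem inwardComponent_eq (x : M) (v : TangentSpace (𝓡∂ (m + 1)) x) :
    inwardComponent x v = (show EuclideanSpace ℝ (Fin (m + 1)) from v) 0 := by
  unfold inwardComponent
  have hd : MDifferentiableAt (𝓡∂ (m + 1)) 𝓘(ℝ, EuclideanSpace ℝ (Fin (m + 1)))
      (extChartAt (𝓡∂ (m + 1)) x) x :=
    mdifferentiableAt_extChartAt (mem_chart_source _ x)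
  rw [hd.mvfderiv]
  -- The tangent space at `x` is trivialised by the preferred chart at `x`, and that chart read in
  -- itself is the identity.
  have heq : writtenInExtChartAt (𝓡∂ (m + 1)) 𝓘(ℝ, EuclideanSpace ℝ (Fin (m + 1))) x
      (extChartAt (𝓡∂ (m + 1)) x) =ᶠ[nhdsWithin (extChartAt (𝓡∂ (m + 1)) x x)
        (Set.range (𝓡∂ (m + 1)))] id := by
    filter_upwards [extChartAt_target_mem_nhdsWithin x] with y hy
    exact (extChartAt (𝓡∂ (m + 1)) x).right_inv hy
  have hc : extChartAt (𝓡∂ (m + 1)) x x ∈ Set.range (𝓡∂ (m + 1)) := Set.mem_range_self _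
  have hid := (heq.fderivWithin_eq (heq.eq_of_nhdsWithin hc)).trans
    (fderivWithin_id ((𝓡∂ (m + 1)).uniqueDiffOn _ hc))
  exact congrArg (fun A : EuclideanSpace ℝ (Fin (m + 1)) →L[ℝ] EuclideanSpace ℝ (Fin (m + 1)) =>
    A v 0) hid

/-- A point of a chart domain whose first coordinate vanishes is a boundary point. -/
theorem mem_boundary_of_extChartAt_apply_zero {x y : M}
    (hy : y ∈ (extChartAt (𝓡∂ (m + 1)) x).source) (h0 : extChartAt (𝓡∂ (m + 1)) x y 0 = 0) :
    y ∈ (𝓡∂ (m + 1)).boundary M := by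
  rw [extChartAt_source] at hy
  refine (ModelWithCorners.isBoundaryPoint_iff_of_mem_atlas (n := ∞) (by simp)
    (chart_mem_atlas _ x) hy).2 ?_
  have hfr : extChartAt (𝓡∂ (m + 1)) x y ∈ frontier (Set.range (𝓡∂ (m + 1))) := by
    rw [frontier_range_modelWithCornersEuclideanHalfSpace]
    exact h0.symm
  refine ⟨subset_closure ((extChartAt (𝓡∂ (m + 1)) x).map_source
    (by rwa [extChartAt_source])), fun hint => hfr.2 ?_⟩
  exact OpenPartialHomeomorph.interior_extend_target_subset_interior_range _ hint

/-- The derivative of a function that vanishes on `∂M` vanishes in the directions tangent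
to `∂M`. -/
theorem mvfderiv_eq_zero_of_eq_zero_on_boundary {F : Type*} [NormedAddCommGroup F]
    [NormedSpace ℝ F] {f : M → F} {x : M} (hx : x ∈ (𝓡∂ (m + 1)).boundary M)
    (hf : MDifferentiableAt (𝓡∂ (m + 1)) 𝓘(ℝ, F) f x)
    (hf0 : ∀ᶠ y in nhds x, y ∈ (𝓡∂ (m + 1)).boundary M → f y = 0)
    {v : TangentSpace (𝓡∂ (m + 1)) x} (hv : inwardComponent x v = 0) :
    mvfderiv (𝓡∂ (m + 1)) f x v = 0 := by
  rw [inwardComponent_eq] at hv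
  set w : EuclideanSpace ℝ (Fin (m + 1)) := v with hw
  set c := extChartAt (𝓡∂ (m + 1)) x x with hc
  have hc0 : c 0 = 0 := by
    have : c ∈ frontier (Set.range (𝓡∂ (m + 1))) := hx
    rw [frontier_range_modelWithCornersEuclideanHalfSpace] at this
    exact this.symm
  -- Both `c` and `w` have zero first coordinate, so this line stays in the bounding hyperplane and
  -- its short pieces come from `∂M`. Along it `f` is zero, while the chain rule gives the
  -- derivative of `f` along `v`.
  let γ : ℝ → EuclideanSpace ℝ (Fin (m + 1)) := fun t => c + t • w
  have hγ0 : ∀ t, γ t 0 = 0 := fun t => by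
    have hw0 : w 0 = 0 := hv
    simp [γ, hc0, hw0]
  have hγr : ∀ t, γ t ∈ Set.range (𝓡∂ (m + 1)) := fun t => by
    rw [range_modelWithCornersEuclideanHalfSpace]
    exact (hγ0 t).ge
  have hγc : γ 0 = c := by simp [γ]
  have hγd : HasDerivAt γ w 0 := by
    have := ((hasDerivAt_id (0 : ℝ)).smul_const w).const_add c
    rwa [one_smul] at this
  have hγt : Filter.Tendsto γ (nhds 0) (nhdsWithin c (Set.range (𝓡∂ (m + 1)))) :=
    tendsto_nhdsWithin_iff.2 ⟨hγc ▸ hγd.continuousAt, Filter.Eventually.of_forall hγr⟩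
  have hd := hf.differentiableWithinAt_writtenInExtChartAt.hasFDerivWithinAt
  rw [hf.mvfderiv]
  set g := writtenInExtChartAt (𝓡∂ (m + 1)) 𝓘(ℝ, F) x f with hg
  have hcomp : HasDerivAt (g ∘ γ)
      (fderivWithin ℝ g (Set.range (𝓡∂ (m + 1))) c w) 0 := by
    rw [← hasDerivWithinAt_univ]
    refine HasFDerivWithinAt.comp_hasDerivWithinAt (t := Set.range (𝓡∂ (m + 1))) 0 ?_
      hγd.hasDerivWithinAt (fun t _ => hγr t)
    rw [hγc]; exact hd
  have hev : g ∘ γ =ᶠ[nhds 0] fun _ => 0 := by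
    have h1 := hγt.eventually (extChartAt_target_mem_nhdsWithin (I := 𝓡∂ (m + 1)) x)
    have h2 : Filter.Tendsto (fun t => (extChartAt (𝓡∂ (m + 1)) x).symm (γ t)) (nhds 0)
        (nhds x) := by
      have := (continuousAt_extChartAt_symm (I := 𝓡∂ (m + 1)) x).tendsto
      rw [extChartAt_to_inv] at this
      exact this.comp (hγt.mono_right nhdsWithin_le_nhds)
    filter_upwards [h1, h2.eventually hf0] with t ht1 ht2
    have : f ((extChartAt (𝓡∂ (m + 1)) x).symm (γ t)) = 0 := ht2 <|
      mem_boundary_of_extChartAt_apply_zero ((extChartAt (𝓡∂ (m + 1)) x).map_target ht1)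
        (by rw [(extChartAt (𝓡∂ (m + 1)) x).right_inv ht1]; exact hγ0 t)
    exact this
  exact hcomp.unique ((hasDerivAt_const (0 : ℝ) (0 : F)).congr_of_eventuallyEq hev)

end BoundaryDerivative

/-! ### Clifford algebra of a chiral spinor at one point. -/

/-- `T` and `c v` behave as Clifford multiplication by `e⁰` and by the tangent vectors `v ∈ E`. -/
structure IsHypersurfaceClifford {E S : Type*} [NormedAddCommGroup E] [InnerProductSpace ℝ E]
    [NormedAddCommGroup S] [InnerProductSpace ℂ S]
    (T : Module.End ℂ S) (c : E →ₗ[ℝ] Module.End ℂ S) : Prop where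
  time_time : ∀ s, T (T s) = s
  mul_mul : ∀ u v s, c u (c v s) + c v (c u s) = -(2 * inner ℝ u v : ℝ) • s
  time_mul : ∀ v s, T (c v s) = -c v (T s)
  inner_time : ∀ s t, inner ℂ (T s) t = inner ℂ s (T t)
  inner_mul : ∀ v s t, inner ℂ (c v s) t = -inner ℂ s (c v t)

namespace IsHypersurfaceClifford

variable {E S : Type*} [NormedAddCommGroup E] [InnerProductSpace ℝ E]
    [NormedAddCommGroup S] [InnerProductSpace ℂ S]
    {T : Module.End ℂ S} {c : E →ₗ[ℝ] Module.End ℂ S}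

theorem map_real_smul (f : Module.End ℂ S) (r : ℝ) (s : S) : f (r • s) = r • f s := by
  rw [← Complex.coe_smul, map_smul, Complex.coe_smul]

theorem mul_self_of_unit (h : IsHypersurfaceClifford T c) {ν : E} (hν : inner ℝ ν ν = (1 : ℝ))
    (s : S) : c ν (c ν s) = -s := by
  have h1 := h.mul_mul ν ν s
  rw [hν, ← two_smul ℝ (c ν (c ν s)), mul_one, neg_smul, ← smul_neg] at h1
  exact smul_right_injective S (two_ne_zero' ℝ) h1

theorem mul_mul_of_orthogonal (h : IsHypersurfaceClifford T c) {u v : E}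
    (huv : inner ℝ u v = (0 : ℝ)) (s : S) : c u (c v s) = -c v (c u s) := by
  have h1 := h.mul_mul u v s
  rw [huv, mul_zero, neg_zero, zero_smul] at h1
  exact eq_neg_of_add_eq_zero_left h1

variable {ν : E} {a b ε : ℝ} {φ : S}

/-- Multiply the chirality condition by `ν` and use `ν · ν = -1` and `ν · T = -T ν ·`. This is the
form in which chirality is used to eliminate `ν · φ`. -/
theorem chirality_normal_mul (h : IsHypersurfaceClifford T c) (hν : inner ℝ ν ν = (1 : ℝ))
    (hQ : a • T (c ν φ) + (Complex.I * (b : ℂ)) • c ν φ = ε • φ) :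
    ε • c ν φ = a • T φ - (Complex.I * (b : ℂ)) • φ := by
  have h1 := congrArg (c ν) hQ
  rw [map_add, map_real_smul, map_real_smul, map_smul, h.time_mul, map_neg,
    h.mul_self_of_unit hν, h.mul_self_of_unit hν, neg_neg, smul_neg, ← sub_eq_add_neg] at h1
  exact h1.symm

/-- A product of two anticommuting skew-Hermitian operators is skew-Hermitian. -/
theorem re_inner_mul_mul_self (h : IsHypersurfaceClifford T c) {u : E}
    (hu : inner ℝ u ν = (0 : ℝ)) : (inner ℂ φ (c u (c ν φ))).re = 0 := by
  have h1 : inner ℂ φ (c u (c ν φ)) = -inner ℂ (c u (c ν φ)) φ := by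
    rw [h.inner_mul, h.inner_mul, neg_neg, h.mul_mul_of_orthogonal hu, inner_neg_right]
  have h2 := congrArg Complex.re h1
  rw [Complex.neg_re, ← inner_conj_symm (c u (c ν φ)) φ, Complex.conj_re] at h2
  linarith

/-- Apply `c u` to `chirality_normal_mul` and take the real part against `φ`: the left side vanishes
by skewness. -/
theorem mul_shift_eq (h : IsHypersurfaceClifford T c) (hν : inner ℝ ν ν = (1 : ℝ))
    (hQ : a • T (c ν φ) + (Complex.I * (b : ℂ)) • c ν φ = ε • φ)
    {u : E} (hu : inner ℝ u ν = (0 : ℝ)) :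
    a * (inner ℂ φ (T (c u φ))).re = b * (inner ℂ φ (c u φ)).im := by
  have h1 := congrArg (fun s => (inner ℂ φ (c u s)).re) (h.chirality_normal_mul hν hQ)
  simp only [map_sub, map_real_smul, map_smul, inner_sub_right, inner_smul_right_eq_smul] at h1
  have h2 : c u (T φ) = -T (c u φ) := by rw [h.time_mul, neg_neg]
  rw [h2, inner_neg_right, Complex.smul_re, h.re_inner_mul_mul_self hu] at h1
  simp at h1
  linarith

/-- For a chiral spinor, the tangential shift is a multiple of `Re ⟨i T φ, u · ν · φ⟩`. -/
theorem mul_re_inner_eq (h : IsHypersurfaceClifford T c) (hν : inner ℝ ν ν = (1 : ℝ))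
    (hab : a ^ 2 + b ^ 2 = 1) (hε : ε * ε = 1)
    (hQ : a • T (c ν φ) + (Complex.I * (b : ℂ)) • c ν φ = ε • φ)
    {u : E} (hu : inner ℝ u ν = (0 : ℝ)) :
    b * (inner ℂ (Complex.I • T φ) (c u (c ν φ))).re = -ε * (inner ℂ φ (T (c u φ))).re := by
  have h1 := congrArg (fun s => (inner ℂ (Complex.I • T φ) (c u s)).re)
    (h.chirality_normal_mul hν hQ)
  simp only [map_sub, map_real_smul, map_smul, inner_sub_right, inner_smul_right_eq_smul,
    inner_smul_left] at h1
  have h2 : inner ℂ (T φ) (c u (T φ)) = -inner ℂ φ (c u φ) := by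
    rw [show c u (T φ) = -T (c u φ) by rw [h.time_mul, neg_neg], inner_neg_right, h.inner_time,
      h.time_time]
  rw [h2, h.inner_time φ (c u φ)] at h1
  have h3 := h.mul_shift_eq hν hQ hu
  rw [inner_smul_left]
  simp at h1 ⊢
  -- `h1` expresses the pairing through `a Im⟨φ, u·φ⟩` and `b X(u)`. After multiplication by `b`,
  -- `h3` turns the first into `a² X(u)`, and `a² + b² = 1` collects the two without dividing by
  -- `b`.
  linear_combination (ε * b) * h1 + (-b * (inner ℂ (T φ) (c u (c ν φ))).im) * hε
    + ε * a * h3 - ε * (inner ℂ φ (T (c u φ))).re * hab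

theorem norm_time (h : IsHypersurfaceClifford T c) (s : S) : ‖T s‖ = ‖s‖ := by
  have h1 : inner ℂ (T s) (T s) = inner ℂ s s := by rw [h.inner_time, h.time_time]
  rw [@norm_eq_sqrt_re_inner ℂ, h1, ← @norm_eq_sqrt_re_inner ℂ]

theorem re_inner_mul_mul (h : IsHypersurfaceClifford T c) (u v : E) (s : S) :
    (inner ℂ (c u s) (c v s)).re = inner ℝ u v * (inner ℂ s s).re := by
  have h1 := congrArg (fun t => (inner ℂ s t).re) (h.mul_mul u v s)
  have h2 : (inner ℂ s (c v (c u s))).re = (inner ℂ s (c u (c v s))).re := by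
    rw [← inner_conj_symm, Complex.conj_re, h.inner_mul, h.inner_mul, neg_neg]
  simp only [inner_add_right, Complex.add_re, inner_smul_right_eq_smul, Complex.smul_re] at h1
  rw [h2, smul_eq_mul] at h1
  rw [h.inner_mul, Complex.neg_re]
  linarith

theorem norm_mul (h : IsHypersurfaceClifford T c) (u : E) (s : S) : ‖c u s‖ = ‖u‖ * ‖s‖ := by
  have h1 := h.re_inner_mul_mul u u s
  have h2 := @inner_self_eq_norm_sq ℂ _ _ _ _ (c u s)
  have h3 := @inner_self_eq_norm_sq ℂ _ _ _ _ s
  simp only [RCLike.re_to_complex] at h2 h3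
  rw [h2, h3, real_inner_self_eq_norm_sq, ← mul_pow] at h1
  exact (pow_left_inj₀ (norm_nonneg _) (by positivity) two_ne_zero).1 h1

/-- The tangential shift of a chiral spinor is at most `|b|` times its squared norm. -/
theorem abs_shift_le (h : IsHypersurfaceClifford T c) (hν : inner ℝ ν ν = (1 : ℝ))
    (hab : a ^ 2 + b ^ 2 = 1) (hε : ε * ε = 1)
    (hQ : a • T (c ν φ) + (Complex.I * (b : ℂ)) • c ν φ = ε • φ)
    {u : E} (hu : inner ℝ u ν = (0 : ℝ)) :
    |(inner ℂ φ (T (c u φ))).re| ≤ |b| * (‖u‖ * (inner ℂ φ φ).re) := by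
  have h1 := congrArg abs (h.mul_re_inner_eq hν hab hε hQ hu)
  have hε' : |ε| = 1 := by
    have := congrArg abs hε
    rw [abs_mul, abs_one, ← sq] at this
    exact (pow_eq_one_iff_of_nonneg (abs_nonneg _) two_ne_zero).1 this
  rw [abs_mul, abs_mul, abs_neg, hε', one_mul] at h1
  rw [← h1]
  have hν' : ‖ν‖ = 1 := by
    rw [real_inner_self_eq_norm_sq] at hν
    exact (pow_eq_one_iff_of_nonneg (norm_nonneg _) two_ne_zero).1 hν
  have h3 := @inner_self_eq_norm_sq ℂ _ _ _ _ φ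
  simp only [RCLike.re_to_complex] at h3
  refine mul_le_mul_of_nonneg_left ((Complex.abs_re_le_norm _).trans
    ((norm_inner_le_norm _ _).trans (le_of_eq ?_))) (abs_nonneg b)
  rw [norm_smul, Complex.norm_I, h.norm_time, h.norm_mul, h.norm_mul, hν', h3]
  ring

/-- The two pairings of `A · ν · φ + (ε b q) i T φ = 0`. -/
theorem pairing_identities (h : IsHypersurfaceClifford T c) (hν : inner ℝ ν ν = (1 : ℝ))
    (hab : a ^ 2 + b ^ 2 = 1) (hε : ε * ε = 1)
    (hQ : a • T (c ν φ) + (Complex.I * (b : ℂ)) • c ν φ = ε • φ)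
    {A : E} (hA : inner ℝ A ν = (0 : ℝ)) {q : ℝ}
    (hAq : c A (c ν φ) + (ε * b * q) • Complex.I • T φ = 0) :
    (∀ u, inner ℝ u ν = (0 : ℝ) →
      inner ℝ A u * (inner ℂ φ φ).re = q * (inner ℂ φ (T (c u φ))).re) ∧
    (inner ℂ φ (T (c A φ))).re = q * (inner ℂ φ φ).re * b ^ 2 := by
  have hN : (inner ℂ (c ν φ) (c ν φ)).re = (inner ℂ φ φ).re := by
    rw [h.re_inner_mul_mul, hν, one_mul]
  constructor
  · intro u hu
    -- The first term yields `⟨A, u⟩ N` because `ν ·` is an isometry; the factor `b` in the second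
    -- is exactly the one `mul_re_inner_eq` needs.
    have h1 := congrArg (fun s => (inner ℂ s (c u (c ν φ))).re) hAq
    simp only [inner_add_left, inner_smul_left_eq_smul, inner_zero_left, Complex.add_re,
      Complex.smul_re, Complex.zero_re, h.re_inner_mul_mul A u, hN, smul_eq_mul] at h1
    have h2 := h.mul_re_inner_eq hν hab hε hQ hu
    linear_combination h1 - ε * q * h2 + q * (inner ℂ φ (T (c u φ))).re * hε
  -- Here the factor `b` for `mul_re_inner_eq` has to be supplied by multiplying the pairing by `b`,
  -- whence `b ^ 2`.
  · have h1 := congrArg (fun s => (inner ℂ (Complex.I • T φ) s).re) hAq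
    have h3 : inner ℂ (Complex.I • T φ) (Complex.I • T φ) = inner ℂ φ φ := by
      rw [inner_smul_left, inner_smul_right, h.inner_time, h.time_time]
      simp [← mul_assoc]
    simp only [inner_add_right, inner_smul_right_eq_smul _ _ (ε * b * q), inner_zero_right,
      Complex.add_re, Complex.smul_re, Complex.zero_re, h3, smul_eq_mul] at h1
    have h2 := h.mul_re_inner_eq hν hab hε hQ hA
    linear_combination ε * h2 - ε * b * h1 - (inner ℂ φ (T (c A φ))).re * hε
      + q * b ^ 2 * (inner ℂ φ φ).re * hε

end IsHypersurfaceClifford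

/-! ### The equality case of Cauchy–Schwarz. -/

/-- Equality in the Cauchy–Schwarz inequality makes `X` an eigenvector of `A`. -/
theorem sum_mul_eq_trace_mul {κ : Type*} [Fintype κ] (A : κ → κ → ℝ) (q X : κ → ℝ) {N b : ℝ}
    (hN : 0 ≤ N) (hX : ∑ α, X α ^ 2 ≤ b ^ 2 * N ^ 2)
    (hA : ∀ α γ, A α γ * N = q α * X γ) (hb : |b| * √(∑ α, q α ^ 2) ≤ ∑ α, A α α) (α : κ) :
    ∑ β, A α β * X β = (∑ β, A β β) * X α := by
  rcases hN.eq_or_lt with rfl | hN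
  · have h0 : ∀ β, X β = 0 := fun β => by
      have h1 := Finset.single_le_sum (f := fun α => X α ^ 2) (fun i _ => sq_nonneg (X i))
        (Finset.mem_univ β)
      exact pow_eq_zero_iff two_ne_zero |>.1 (le_antisymm (by simpa using h1.trans hX) (sq_nonneg _))
    simp [h0]
  set s := ∑ α, X α ^ 2 with hs
  set r := ∑ α, q α ^ 2 with hr
  set d := ∑ α, q α * X α with hd
  have htr : (∑ β, A β β) * N = d := by
    rw [Finset.sum_mul, hd]
    exact Finset.sum_congr rfl fun β _ => hA β β
  have hr0 : 0 ≤ r := Finset.sum_nonneg fun i _ => sq_nonneg _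
  have hs0 : 0 ≤ s := Finset.sum_nonneg fun i _ => sq_nonneg _
  -- The reverse Cauchy–Schwarz inequality: `N tr A = d`, so `hb` gives `|b| √r N ≤ d`, and `hX`
  -- gives `s ≤ b² N²`.
  have hd2 : s * r ≤ d ^ 2 := by
    have h1 : |b| * √r * N ≤ d := htr ▸ mul_le_mul_of_nonneg_right hb hN.le
    have h2 : (|b| * √r * N) ^ 2 ≤ d ^ 2 := pow_le_pow_left₀ (by positivity) h1 2
    rw [mul_pow, mul_pow, sq_abs, Real.sq_sqrt hr0] at h2
    calc s * r ≤ b ^ 2 * N ^ 2 * r := mul_le_mul_of_nonneg_right hX hr0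
      _ = b ^ 2 * r * N ^ 2 := by ring
      _ ≤ d ^ 2 := h2
  -- The residual of projecting `q` onto `X`, with denominators cleared so that `s = 0` needs no
  -- separate case. By `hd2` this sum of squares is nonpositive, so each term vanishes.
  have hsum : ∑ β, (q β * s - d * X β) ^ 2 = s * (s * r - d ^ 2) := by
    have h1 : ∀ β, (q β * s - d * X β) ^ 2 =
        s ^ 2 * q β ^ 2 - 2 * s * d * (q β * X β) + d ^ 2 * X β ^ 2 := fun β => by ring
    simp only [h1, Finset.sum_add_distrib, Finset.sum_sub_distrib, ← Finset.mul_sum, ← hs, ← hr,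
      ← hd]
    ring
  have h2 := Finset.single_le_sum (f := fun β => (q β * s - d * X β) ^ 2)
    (fun i _ => sq_nonneg _) (Finset.mem_univ α)
  have h3 : q α * s - d * X α = 0 :=
    pow_eq_zero_iff two_ne_zero |>.1 (le_antisymm
      ((h2.trans_eq hsum).trans (mul_nonpos_of_nonneg_of_nonpos hs0 (by linarith)))
      (sq_nonneg _))
  have h4 : (∑ β, A α β * X β) * N = q α * s := by
    rw [Finset.sum_mul, hs, Finset.mul_sum]
    exact Finset.sum_congr rfl fun β _ => by linear_combination X β * hA α β
  exact mul_right_cancel₀ hN.ne' (by linear_combination h4 + h3 - X α * htr)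

/-! ### The spin connection and the differentiated chirality condition. -/

namespace IsHypersurfaceClifford

variable {E S : Type*} [NormedAddCommGroup E] [InnerProductSpace ℝ E]
    [NormedAddCommGroup S] [InnerProductSpace ℂ S]
    {T : Module.End ℂ S} {c : E →ₗ[ℝ] Module.End ℂ S}

/-- The spin connection term `¼ ∑ ⟨Γ_i, f_j⟩ f_i · f_j ·`. -/
def spinTerm {κ : Type*} [Fintype κ] (c : E →ₗ[ℝ] Module.End ℂ S) (f Γ : κ → E) :
    Module.End ℂ S :=
  (1 / 4 : ℝ) • ∑ i, ∑ j, (inner ℝ (Γ i) (f j) : ℝ) • (c (f i) * c (f j))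

theorem spinTerm_apply {κ : Type*} [Fintype κ] (f Γ : κ → E) (s : S) :
    spinTerm c f Γ s =
      (1 / 4 : ℝ) • ∑ i, ∑ j, (inner ℝ (Γ i) (f j) : ℝ) • c (f i) (c (f j) s) := by
  simp [spinTerm]

theorem time_spinTerm (h : IsHypersurfaceClifford T c) {κ : Type*} [Fintype κ] (f Γ : κ → E)
    (s : S) : T (spinTerm c f Γ s) = spinTerm c f Γ (T s) := by
  simp only [spinTerm_apply, map_real_smul, map_sum, h.time_mul, map_neg, neg_neg]

/-- Move `w` past `u` and then past `v`; each move costs one inner product and the two signs cancel.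
-/
theorem mul_mul_mul_sub (h : IsHypersurfaceClifford T c) (u v w : E) (s : S) :
    c w (c u (c v s)) - c u (c v (c w s)) =
      (2 * inner ℝ v w : ℝ) • c u s - (2 * inner ℝ w u : ℝ) • c v s := by
  have h1 := h.mul_mul w u (c v s)
  have h2 := congrArg (c u) (h.mul_mul w v s)
  rw [map_add, map_real_smul, real_inner_comm] at h2
  rw [eq_sub_iff_add_eq.2 h1, ← sub_eq_iff_eq_add.2 h2.symm]
  module

/-- The algebraic half of the Leibniz rule `∇(ν·φ) = (∇ν)·φ + ν·∇φ`. Each commutator `[ν, f_i f_j]`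
contributes two terms, equal after summation since the connection matrix is antisymmetric; hence the
factor `¼` in the spin connection. -/
theorem mul_spinTerm_sub (h : IsHypersurfaceClifford T c) {κ : Type*} [Fintype κ] {f Γ : κ → E}
    (hΓ : ∀ i j, inner ℝ (Γ i) (f j) + inner ℝ (f i) (Γ j) = (0 : ℝ)) {ν : E}
    (hν : ∑ i, (inner ℝ (f i) ν : ℝ) • f i = ν) (s : S) :
    c ν (spinTerm c f Γ s) - spinTerm c f Γ (c ν s) =
      c (∑ i, (inner ℝ (Γ i) ν : ℝ) • f i) s := by
  have hΓν : ∀ i, (inner ℝ (Γ i) ν : ℝ) = ∑ j, inner ℝ (Γ i) (f j) * inner ℝ (f j) ν := fun i => by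
    conv_lhs => rw [← hν]
    simp only [inner_sum, inner_smul_right]
    exact Finset.sum_congr rfl fun j _ => mul_comm _ _
  have h1 : ∑ i, ∑ j, ((inner ℝ (Γ i) (f j) : ℝ) * inner ℝ ν (f i)) • c (f j) s =
      -∑ i, ∑ j, ((inner ℝ (Γ i) (f j) : ℝ) * inner ℝ (f j) ν) • c (f i) s := by
    rw [Finset.sum_comm, ← Finset.sum_neg_distrib]
    refine Finset.sum_congr rfl fun i _ => ?_
    rw [← Finset.sum_neg_distrib]
    refine Finset.sum_congr rfl fun j _ => ?_
    rw [← neg_smul]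
    congr 1
    have := hΓ j i
    rw [real_inner_comm (Γ i)] at this
    rw [real_inner_comm (f j) ν]
    linear_combination (inner ℝ (f j) ν) * this
  calc c ν (spinTerm c f Γ s) - spinTerm c f Γ (c ν s)
      = (1 / 4 : ℝ) • ∑ i, ∑ j, (inner ℝ (Γ i) (f j) : ℝ) •
          (c ν (c (f i) (c (f j) s)) - c (f i) (c (f j) (c ν s))) := by
        simp only [spinTerm_apply, map_real_smul, map_sum, smul_sub, Finset.sum_sub_distrib]
    _ = (1 / 2 : ℝ) • (∑ i, ∑ j, ((inner ℝ (Γ i) (f j) : ℝ) * inner ℝ (f j) ν) • c (f i) s -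
          ∑ i, ∑ j, ((inner ℝ (Γ i) (f j) : ℝ) * inner ℝ ν (f i)) • c (f j) s) := by
        simp only [← Finset.sum_sub_distrib, Finset.smul_sum, h.mul_mul_mul_sub]
        refine Finset.sum_congr rfl fun i _ => Finset.sum_congr rfl fun j _ => ?_
        module
    _ = ∑ i, ∑ j, ((inner ℝ (Γ i) (f j) : ℝ) * inner ℝ (f j) ν) • c (f i) s := by
        rw [h1]
        module
    _ = c (∑ i, (inner ℝ (Γ i) ν : ℝ) • f i) s := by
        simp only [hΓν, map_sum, map_smul, LinearMap.sum_apply, LinearMap.smul_apply,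
          Finset.sum_smul]

variable {ν : E} {a b ε : ℝ} {φ : S}

/-- The differentiated chirality condition, for a spinor `φ` with derivative `φ'` determined by
the equation `∇̃φ = 0`. -/
theorem differentiated_chirality (h : IsHypersurfaceClifford T c) (hν : inner ℝ ν ν = (1 : ℝ))
    (hε : ε * ε = 1)
    (hQ : a • T (c ν φ) + (Complex.I * (b : ℂ)) • c ν φ = ε • φ)
    {κ : Type*} [Fintype κ] {f Γ : κ → E}
    (hΓ : ∀ i j, inner ℝ (Γ i) (f j) + inner ℝ (f i) (Γ j) = (0 : ℝ))
    (hf : ∑ i, (inner ℝ (f i) ν : ℝ) • f i = ν)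
    {k u : E} {q : ℝ} (hu : inner ℝ u ν = (0 : ℝ)) {φ' : S}
    (hφ' : φ' + spinTerm c f Γ φ - (1 / 2 : ℝ) • c (u + q • ν) (T φ) = 0)
    (hD : a • T (c k φ + c (∑ i, (inner ℝ (Γ i) ν : ℝ) • f i) φ + c ν φ') +
      (Complex.I * (b : ℂ)) • (c k φ + c (∑ i, (inner ℝ (Γ i) ν : ℝ) • f i) φ + c ν φ') =
        ε • φ') :
    c (k + (ε * a) • u) (c ν φ) + (ε * b * q) • Complex.I • T φ = 0 := by
  -- `Q` factors as `F ∘ c ν`, and `F` commutes with the spin term because `T` passes two Clifford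
  -- factors.
  set F : Module.End ℂ S := (a : ℂ) • T + (Complex.I * (b : ℂ)) • 1 with hF
  have hFa : ∀ s, a • T s + (Complex.I * (b : ℂ)) • s = F s := fun s => by simp [hF]
  set G := spinTerm c f Γ
  have hG : ∀ s, G (F s) = F (G s) := fun s => by
    simp only [← hFa, map_add, map_real_smul, map_smul, G, h.time_spinTerm]
  rw [hFa] at hQ hD
  obtain rfl : φ' = (1 / 2 : ℝ) • c (u + q • ν) (T φ) - G φ := by
    rw [eq_sub_iff_add_eq]; exact sub_eq_zero.1 hφ'
  -- All spin connection terms cancel: by the commutator formula the left side is `-F (G (ν·φ)) = -G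
  -- (Qφ)`.
  have h1 : F (c (∑ i, (inner ℝ (Γ i) ν : ℝ) • f i) φ) - F (c ν (G φ)) = -(ε • G φ) := by
    rw [← map_sub, ← h.mul_spinTerm_sub hΓ hf, sub_sub_cancel_left, map_neg, ← hG, hQ,
      map_real_smul]
  have h2 : F (c k φ) = -(ε • c k (c ν φ)) := by
    rw [← map_real_smul (c k), h.chirality_normal_mul hν ((hFa _).trans hQ), ← hFa]
    simp only [map_sub, map_real_smul, map_smul, h.time_mul]
    module
  -- The tangential part of `p` sees only the `cos θ` half of `Q`; the normal part, in `h5`, sees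
  -- only the `sin θ` half.
  have h3 : F (c ν (c u (T φ))) - ε • c u (T φ) = -((2 * a) • c u (c ν φ)) := by
    have h4 : ε • c u (T φ) = c u (T (F (c ν φ))) := by rw [hQ, map_real_smul, map_real_smul]
    rw [h4, ← hFa, ← hFa]
    simp only [map_add, map_real_smul, map_smul, h.time_mul, h.time_time, map_neg, neg_neg,
      h.mul_mul_of_orthogonal hu]
    module
  have h5 : F (c ν (c ν (T φ))) - ε • c ν (T φ) = -((2 * b) • Complex.I • T φ) := by
    have h6 : ε • c ν (T φ) = -T (ε • c ν φ) := by
      rw [map_real_smul, h.time_mul, smul_neg, neg_neg]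
    rw [h6, h.chirality_normal_mul hν ((hFa _).trans hQ), h.mul_self_of_unit hν, ← hFa]
    simp only [map_sub, map_real_smul, map_smul, map_neg, h.time_time]
    rw [← Complex.coe_smul (2 * b)]
    push_cast
    module
  have h7 : -(ε • c k (c ν φ)) - a • c u (c ν φ) - (b * q) • Complex.I • T φ = 0 := by
    simp only [map_add, map_sub, map_real_smul, map_smul, LinearMap.add_apply,
      LinearMap.smul_apply] at hD
    rw [h2] at hD
    have h8 := sub_eq_zero.2 hD
    linear_combination (norm := module) h8 - h1 - (1 / 2 : ℝ) • h3 - (q / 2) • h5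
  have h9 := congrArg (fun s => (-ε) • s) h7
  simp only [map_add, map_smul, LinearMap.add_apply, LinearMap.smul_apply]
  simp only [smul_sub, smul_neg, smul_smul, smul_zero, neg_mul, hε] at h9
  rw [← h9]
  module

end IsHypersurfaceClifford

/-! ### Orthonormal expansions. -/

section Expansion

variable {E : Type*} [NormedAddCommGroup E] [InnerProductSpace ℝ E]

/-- An orthonormal family of full cardinality is an orthonormal basis. -/
theorem exists_orthonormalBasis_of_card {n : ℕ} (hn : Module.finrank ℝ E = n + 1)
    {f : Fin (n + 1) → E} (hf : Orthonormal ℝ f) :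
    ∃ b : OrthonormalBasis (Fin (n + 1)) ℝ E, ⇑b = f := by
  have hcard : Fintype.card (Fin (n + 1)) = Module.finrank ℝ E := by rw [hn, Fintype.card_fin]
  refine ⟨(basisOfOrthonormalOfCardEqFinrank hf hcard).toOrthonormalBasis ?_, ?_⟩
  · rwa [coe_basisOfOrthonormalOfCardEqFinrank]
  · rw [Module.Basis.coe_toOrthonormalBasis, coe_basisOfOrthonormalOfCardEqFinrank]

theorem exists_orthonormalBasis_cons {n : ℕ} (hn : Module.finrank ℝ E = n + 1)
    {e : Fin n → E} (he : Orthonormal ℝ e) {ν : E} (hν : inner ℝ ν ν = (1 : ℝ))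
    (hνe : ∀ α, inner ℝ ν (e α) = (0 : ℝ)) :
    ∃ b : OrthonormalBasis (Fin (n + 1)) ℝ E, ⇑b = Fin.cons ν e := by
  refine exists_orthonormalBasis_of_card hn ?_
  rw [orthonormal_iff_ite] at he ⊢
  intro i j
  refine Fin.cases ?_ (fun i => ?_) i <;> refine Fin.cases ?_ (fun j => ?_) j
  · simpa using hν
  · simpa [Fin.ext_iff] using hνe j
  · simpa [Fin.ext_iff, real_inner_comm] using hνe i
  · simpa using he i j

/-- Both sides are the Riesz representative of `ℓ`. This passes from the spin frame to a frame
adapted to `∂M`. -/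
theorem sum_apply_smul_eq {κ κ' : Type*} [Fintype κ] [Fintype κ'] (b : OrthonormalBasis κ ℝ E)
    (b' : OrthonormalBasis κ' ℝ E) (ℓ : E →ₗ[ℝ] ℝ) :
    ∑ i, ℓ (b i) • b i = ∑ i, ℓ (b' i) • b' i := by
  have key : ∀ {κ : Type _} [Fintype κ] (b : OrthonormalBasis κ ℝ E) (w : E),
      inner ℝ (∑ i, ℓ (b i) • b i) w = ℓ w := fun b w => by
    conv_rhs => rw [← b.sum_repr' w]
    simp [sum_inner, inner_smul_left, mul_comm]
  have key' : ∀ w : E, inner ℝ (∑ i, ℓ (b' i) • b' i) w = ℓ w := fun w => by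
    conv_rhs => rw [← b'.sum_repr' w]
    simp [sum_inner, inner_smul_left, mul_comm]
  exact ext_inner_right ℝ fun w => (key b w).trans (key' w).symm

end Expansion

/-! ### The Clifford relations in a spinor module. -/

namespace SpinorModule

variable {n : ℕ} {S : Type*} [NormedAddCommGroup S] [InnerProductSpace ℂ S]
  (W : SpinorModule n S)

theorem lorentzForm_apply (t : ℝ) (v : Fin n → ℝ) :
    lorentzForm n (t, v) = t * t - ∑ i, v i * v i := by
  simp [lorentzForm, riemForm, QuadraticMap.weightedSumSquares_apply, sub_eq_add_neg]

theorem rep_ι_anticomm (t t' : ℝ) (v v' : Fin n → ℝ) (s : S) :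
    W.rep (CliffordAlgebra.ι _ (t, v)) (W.rep (CliffordAlgebra.ι _ (t', v')) s) +
      W.rep (CliffordAlgebra.ι _ (t', v')) (W.rep (CliffordAlgebra.ι _ (t, v)) s) =
        (2 * (t * t' - ∑ i, v i * v' i)) • s := by
  have h := congrArg (fun A => W.rep A s)
    (CliffordAlgebra.ι_mul_ι_add_swap (Q := lorentzForm n) (t, v) (t', v'))
  simp only [map_add, map_mul, AlgHom.commutes, LinearMap.add_apply, Module.End.mul_apply,
    Module.algebraMap_end_apply] at h
  rw [h]
  congr 1
  simp only [QuadraticMap.polar, Prod.mk_add_mk, lorentzForm_apply, Pi.add_apply, add_mul, mul_add,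
    Finset.sum_add_distrib, mul_comm (v' _) (v _)]
  ring

/-- Clifford multiplication by spacelike vectors, as a linear map. -/
def spaceₗ : (Fin n → ℝ) →ₗ[ℝ] Module.End ℂ S :=
  W.rep.toLinearMap ∘ₗ CliffordAlgebra.ι (lorentzForm n) ∘ₗ LinearMap.inr ℝ ℝ (Fin n → ℝ)

theorem spaceₗ_apply (v : Fin n → ℝ) : W.spaceₗ v = W.space v := rfl

theorem space_eq_sum (v : Fin n → ℝ) (s : S) :
    W.space v s = ∑ i, v i • W.space (Pi.single i 1) s := by
  simp only [← spaceₗ_apply]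
  conv_lhs => rw [pi_eq_sum_univ' v]
  simp [LinearMap.sum_apply]

theorem isHypersurfaceClifford {E : Type*} [NormedAddCommGroup E] [InnerProductSpace ℝ E]
    (b : OrthonormalBasis (Fin n) ℝ E) :
    IsHypersurfaceClifford W.time
      (W.spaceₗ ∘ₗ LinearMap.pi fun i => (innerSL ℝ (b i)).toLinearMap) where
  time_time s := by
    have h := W.rep_ι_anticomm 1 1 0 0 s
    rw [← two_smul ℝ] at h
    simp only [Pi.zero_apply, mul_zero, Finset.sum_const_zero, sub_zero, mul_one] at h
    exact smul_right_injective S (two_ne_zero' ℝ) h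
  mul_mul u v s := by
    refine (W.rep_ι_anticomm 0 0 _ _ s).trans ?_
    rw [← b.sum_inner_mul_inner u v]
    simp [real_inner_comm]
  time_mul v s := by
    refine eq_neg_of_add_eq_zero_left ((W.rep_ι_anticomm 1 0 0 _ s).trans ?_)
    simp
  inner_time s t := by
    have h := W.adjoint_rep 1 0 s t
    rwa [neg_zero] at h
  inner_mul v s t := by
    have hneg : ∀ w : Fin n → ℝ,
        W.rep (CliffordAlgebra.ι (lorentzForm n) (0, -w)) = -W.spaceₗ w := W.spaceₗ.map_neg
    refine (W.adjoint_rep 0 _ s t).trans ?_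
    rw [hneg, LinearMap.neg_apply, inner_neg_right]
    rfl

end SpinorModule

/-! ### A product rule for operators with variable coefficients. -/

section Calculus

variable {m : ℕ} {M : Type*} [TopologicalSpace M] [ChartedSpace (EuclideanHalfSpace (m + 1)) M]
  {S : Type*} [NormedAddCommGroup S] [NormedSpace ℝ S]

theorem mvfderiv_sum_smul_sub {κ : Type*} [Fintype κ] {g : κ → M → ℝ} {φ : M → S} {x : M}
    (hg : ∀ i, MDifferentiableAt (𝓡∂ (m + 1)) 𝓘(ℝ, ℝ) (g i) x)
    (hφ : MDifferentiableAt (𝓡∂ (m + 1)) 𝓘(ℝ, S) φ x) (K : κ → S →L[ℝ] S) (L : S →L[ℝ] S) :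
    MDifferentiableAt (𝓡∂ (m + 1)) 𝓘(ℝ, S) (fun y => ∑ i, g i y • K i (φ y) - L (φ y)) x ∧
    ∀ v, mvfderiv (𝓡∂ (m + 1)) (fun y => ∑ i, g i y • K i (φ y) - L (φ y)) x v =
      ∑ i, (g i x • K i (mvfderiv (𝓡∂ (m + 1)) φ x v) +
        mvfderiv (𝓡∂ (m + 1)) (g i) x v • K i (φ x)) - L (mvfderiv (𝓡∂ (m + 1)) φ x v) := by
  set D : TangentSpace (𝓡∂ (m + 1)) x →L[ℝ] S :=
    ∑ i, (g i x • (K i).comp (mvfderiv (𝓡∂ (m + 1)) φ x) +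
      (mvfderiv (𝓡∂ (m + 1)) (g i) x).smulRight (K i (φ x))) -
      L.comp (mvfderiv (𝓡∂ (m + 1)) φ x) with hD
  have h : HasMFDerivAt (𝓡∂ (m + 1)) 𝓘(ℝ, S) (fun y => ∑ i, g i y • K i (φ y) - L (φ y)) x D := by
    refine ⟨?_, ?_⟩
    · have := hφ.continuousAt
      have hc := fun i => (hg i).continuousAt
      fun_prop
    · set σ := (extChartAt (𝓡∂ (m + 1)) x).symm
      have hσ : σ (extChartAt (𝓡∂ (m + 1)) x x) = x := extChartAt_to_inv x
      have h1 : HasFDerivWithinAt (fun z => φ (σ z)) (mvfderiv (𝓡∂ (m + 1)) φ x) _ _ :=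
        hφ.hasMFDerivAt.2
      have h2 := fun i => (K i).hasFDerivAt.comp_hasFDerivWithinAt _ h1
      have h3 : ∀ i, HasFDerivWithinAt (fun z => g i (σ z))
        (mvfderiv (𝓡∂ (m + 1)) (g i) x) _ _ := fun i => (hg i).hasMFDerivAt.2
      have h4 := (HasFDerivWithinAt.fun_sum (u := Finset.univ) fun i _ => (h3 i).smul (h2 i)).sub
        (L.hasFDerivAt.comp_hasFDerivWithinAt _ h1)
      simp only [Function.comp_apply, hσ] at h4
      exact h4
  have hfd : mvfderiv (𝓡∂ (m + 1)) (fun y => ∑ i, g i y • K i (φ y) - L (φ y)) x = D := h.mfderiv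
  refine ⟨h.mdifferentiableAt, fun v => ?_⟩
  rw [hfd, hD]
  simp

theorem mvfderiv_eq_zero_of_eventuallyEq_const {f : M → S} {x : M} {r : S} (hf : f =ᶠ[nhds x] fun _ => r)
    (v : TangentSpace (𝓡∂ (m + 1)) x) : mvfderiv (𝓡∂ (m + 1)) f x v = 0 := by
  have h1 : mvfderiv (𝓡∂ (m + 1)) f x = 0 :=
    (hf.mfderiv_eq (I := 𝓡∂ (m + 1)) (I' := 𝓘(ℝ, S))).trans (mfderiv_const ..)
  rw [h1]; rfl

end Calculus

/-! ### Differentiating the boundary condition in a local frame. -/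

section Boundary

variable {m : ℕ} {M : Type*} [TopologicalSpace M] [ChartedSpace (EuclideanHalfSpace (m + 1)) M]
  [RiemannianBundle (fun x : M => TangentSpace (𝓡∂ (m + 1)) x)]
  [IsManifold (𝓡∂ (m + 1)) ∞ M]
  {ι : Type*} {S : Type*} [NormedAddCommGroup S] [InnerProductSpace ℂ S]

theorem IsOutwardNormal.mdifferentiableAt {η : ∀ x : M, TangentSpace (𝓡∂ (m + 1)) x}
    (hη : IsOutwardNormal η) {x : M} (hx : x ∈ (𝓡∂ (m + 1)).boundary M) :
    MDifferentiableAt (𝓡∂ (m + 1)) (𝓡∂ (m + 1)).tangent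
      (fun y => (⟨y, η y⟩ : TangentBundle (𝓡∂ (m + 1)) M)) x :=
  (hη.smooth x hx).mdifferentiableAt (by simp)

theorem SpinStructure.mdifferentiableAt_frame (P : SpinStructure m M ι) {a : ι} {x : M}
    (hx : x ∈ P.U a) (i : Fin (m + 1)) :
    MDifferentiableAt (𝓡∂ (m + 1)) (𝓡∂ (m + 1)).tangent
      (fun y => (⟨y, P.frame a i y⟩ : TangentBundle (𝓡∂ (m + 1)) M)) x :=
  ((P.frame_smooth a i).contMDiffAt ((P.isOpen a).mem_nhds hx)).mdifferentiableAt (by simp)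

/-- Clifford multiplication by a frame vector is a constant operator, so in a local frame `Q` varies
only through the components of `η`. -/
theorem chirality_eq_sum (P : SpinStructure m M ι) (W : SpinorModule (m + 1) S)
    (η : ∀ x : M, TangentSpace (𝓡∂ (m + 1)) x) (θ : ℝ) (a : ι) (y : M) (s : S) :
    chirality P W η θ a y s = ∑ i, (inner ℝ (P.frame a i y) (η y) : ℝ) •
      ((Real.cos θ : ℂ) • (W.time * W.space (Pi.single i 1)) +
        (Complex.I * (Real.sin θ : ℂ)) • W.space (Pi.single i 1)) s := by
  rw [chirality, cliffordMul, SpinorModule.space_eq_sum, map_sum, Finset.smul_sum,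
    Finset.smul_sum, ← Finset.sum_add_distrib]
  refine Finset.sum_congr rfl fun i _ => ?_
  rw [IsHypersurfaceClifford.map_real_smul]
  simp only [LinearMap.add_apply, LinearMap.smul_apply, Module.End.mul_apply]
  rw [Complex.coe_smul]
  module

variable [IsContMDiffRiemannianBundle (𝓡∂ (m + 1)) ∞ (EuclideanSpace ℝ (Fin (m + 1)))
    (fun x : M => TangentSpace (𝓡∂ (m + 1)) x)]
  {cov : CovariantDerivative (𝓡∂ (m + 1)) (EuclideanSpace ℝ (Fin (m + 1)))
      (fun x : M => TangentSpace (𝓡∂ (m + 1)) x)}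

set_option synthInstance.maxHeartbeats 400000 in
theorem IsLeviCivita.mvfderiv_inner (hcov : IsLeviCivita cov)
    {σ τ : ∀ x : M, TangentSpace (𝓡∂ (m + 1)) x} {x : M}
    (hσ : MDifferentiableAt (𝓡∂ (m + 1)) (𝓡∂ (m + 1)).tangent
      (fun y => (⟨y, σ y⟩ : TangentBundle (𝓡∂ (m + 1)) M)) x)
    (hτ : MDifferentiableAt (𝓡∂ (m + 1)) (𝓡∂ (m + 1)).tangent
      (fun y => (⟨y, τ y⟩ : TangentBundle (𝓡∂ (m + 1)) M)) x)
    (v : TangentSpace (𝓡∂ (m + 1)) x) :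
    mvfderiv (𝓡∂ (m + 1)) (fun y => (inner ℝ (σ y) (τ y) : ℝ)) x v =
      inner ℝ (cov σ x v) (τ x) + inner ℝ (σ x) (cov τ x v) := by
  classical
  -- Metric compatibility is stated for a direction field; only its value at `x` matters, so a field
  -- supported at `x` will do.
  have h := hcov.1.mvfderiv_inner_eq (Function.update 0 x v) hσ hτ
  simpa only [Function.update_self] using h

set_option synthInstance.maxHeartbeats 400000 in
theorem mdifferentiableAt_inner
    {σ τ : ∀ x : M, TangentSpace (𝓡∂ (m + 1)) x} {x : M}
    (hσ : MDifferentiableAt (𝓡∂ (m + 1)) (𝓡∂ (m + 1)).tangent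
      (fun y => (⟨y, σ y⟩ : TangentBundle (𝓡∂ (m + 1)) M)) x)
    (hτ : MDifferentiableAt (𝓡∂ (m + 1)) (𝓡∂ (m + 1)).tangent
      (fun y => (⟨y, τ y⟩ : TangentBundle (𝓡∂ (m + 1)) M)) x) :
    MDifferentiableAt (𝓡∂ (m + 1)) 𝓘(ℝ, ℝ) (fun y => (inner ℝ (σ y) (τ y) : ℝ)) x :=
  MDifferentiableAt.inner_bundle hσ hτ

/-- The derivative of the unit normal in a tangential direction is tangential. -/
theorem IsOutwardNormal.inner_cov_self (hcov : IsLeviCivita cov)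
    {η : ∀ x : M, TangentSpace (𝓡∂ (m + 1)) x} (hη : IsOutwardNormal η) {x : M}
    (hx : x ∈ (𝓡∂ (m + 1)).boundary M) {v : TangentSpace (𝓡∂ (m + 1)) x}
    (hv : inwardComponent x v = 0) : inner ℝ (cov η x v) (η x) = (0 : ℝ) := by
  have hd := hη.mdifferentiableAt hx
  have hi := mdifferentiableAt_inner hd hd
  have hc : MDifferentiableAt (𝓡∂ (m + 1)) 𝓘(ℝ, ℝ) (fun _ : M => (1 : ℝ)) x :=
    mdifferentiableAt_const
  have h1 := mvfderiv_eq_zero_of_eq_zero_on_boundary hx (hi.sub hc)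
    (Filter.Eventually.of_forall fun y hy => sub_eq_zero.2 (hη.unit y hy)) hv
  rw [mvfderiv_sub hi hc, mvfderiv_const, sub_zero, hcov.mvfderiv_inner hd hd,
    real_inner_comm (cov η x v)] at h1
  linarith

/-- The inner products of the frame fields are constant on `U a`. -/
theorem SpinStructure.cov_frame_antisymm (hcov : IsLeviCivita cov) (P : SpinStructure m M ι)
    {a : ι} {x : M} (hx : x ∈ P.U a) (v : TangentSpace (𝓡∂ (m + 1)) x) (i j : Fin (m + 1)) :
    inner ℝ (cov (P.frame a i) x v) (P.frame a j x) +
      inner ℝ (P.frame a i x) (cov (P.frame a j) x v) = (0 : ℝ) := by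
  rw [← hcov.mvfderiv_inner (P.mdifferentiableAt_frame hx i) (P.mdifferentiableAt_frame hx j)]
  refine mvfderiv_eq_zero_of_eventuallyEq_const (r := if i = j then 1 else 0) ?_ v
  filter_upwards [(P.isOpen a).mem_nhds hx] with y hy
  exact orthonormal_iff_ite.1 (P.orthonormal a y hy) i j

/-- The derivative of `Qφ = εφ` along `∂M`, in the frame over `U a`. -/
theorem ChiralBoundary.sum_derivative_eq_zero [FiniteDimensional ℂ S]
    {P : SpinStructure m M ι} {W : SpinorModule (m + 1) S}
    {η : ∀ x : M, TangentSpace (𝓡∂ (m + 1)) x} (hcov : IsLeviCivita cov)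
    (hη : IsOutwardNormal η) {θ ε : ℝ} {φ : SpinorField P W} (hQ : ChiralBoundary P W η θ ε φ)
    {x : M} (hx : x ∈ (𝓡∂ (m + 1)).boundary M) {a : ι} (hxa : x ∈ P.U a)
    {v : TangentSpace (𝓡∂ (m + 1)) x} (hv : inwardComponent x v = 0) :
    ∑ i, ((inner ℝ (P.frame a i x) (η x) : ℝ) •
        ((Real.cos θ : ℂ) • (W.time * W.space (Pi.single i 1)) +
          (Complex.I * (Real.sin θ : ℂ)) • W.space (Pi.single i 1))
            (mvfderiv (𝓡∂ (m + 1)) (φ.loc a) x v) +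
      (inner ℝ (cov (P.frame a i) x v) (η x) + inner ℝ (P.frame a i x) (cov η x v) : ℝ) •
        ((Real.cos θ : ℂ) • (W.time * W.space (Pi.single i 1)) +
          (Complex.I * (Real.sin θ : ℂ)) • W.space (Pi.single i 1)) (φ.loc a x)) -
      ε • mvfderiv (𝓡∂ (m + 1)) (φ.loc a) x v = 0 := by
  have hφ : MDifferentiableAt (𝓡∂ (m + 1)) 𝓘(ℝ, S) (φ.loc a) x :=
    ((φ.smooth a).contMDiffAt ((P.isOpen a).mem_nhds hxa)).mdifferentiableAt (by simp)
  let K : Fin (m + 1) → S →L[ℝ] S := fun i =>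
    (LinearMap.toContinuousLinearMap ((Real.cos θ : ℂ) • (W.time * W.space (Pi.single i 1)) +
      (Complex.I * (Real.sin θ : ℂ)) • W.space (Pi.single i 1))).restrictScalars ℝ
  have h := mvfderiv_sum_smul_sub (fun i => mdifferentiableAt_inner
    (P.mdifferentiableAt_frame hxa i) (hη.mdifferentiableAt hx)) hφ K
    (ε • ContinuousLinearMap.id ℝ S)
  have h0 := mvfderiv_eq_zero_of_eq_zero_on_boundary hx h.1 (by
    filter_upwards [(P.isOpen a).mem_nhds hxa] with y hya hy
    exact sub_eq_zero.2 ((chirality_eq_sum P W η θ a y _).symm.trans (hQ y hy a hya))) hv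
  rw [h.2 v] at h0
  simp only [hcov.mvfderiv_inner (P.mdifferentiableAt_frame hxa _) (hη.mdifferentiableAt hx)] at h0
  exact h0

end Boundary

/-! ### The identities at a boundary point. -/

section Pointwise

variable {m : ℕ} {M : Type*} [TopologicalSpace M] [ChartedSpace (EuclideanHalfSpace (m + 1)) M]
  [RiemannianBundle (fun x : M => TangentSpace (𝓡∂ (m + 1)) x)]

theorem finrank_tangentSpace (x : M) :
    @Module.finrank ℝ (TangentSpace (𝓡∂ (m + 1)) x) _
      NormedAddCommGroup.toAddCommGroup.toAddCommMonoid NormedSpace.toModule = m + 1 :=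
  finrank_euclideanSpace_fin (𝕜 := ℝ) (n := m + 1)

variable [IsManifold (𝓡∂ (m + 1)) ∞ M]
  {ι : Type*} {S : Type*} [NormedAddCommGroup S] [InnerProductSpace ℂ S]

/-- Clifford multiplication at `x` in the frame over `U a`, as a linear map. -/
def cliffordMulₗ (P : SpinStructure m M ι) (W : SpinorModule (m + 1) S) (a : ι) (x : M) :
    TangentSpace (𝓡∂ (m + 1)) x →ₗ[ℝ] Module.End ℂ S :=
  W.spaceₗ ∘ₗ LinearMap.pi fun i => (innerSL ℝ (P.frame a i x)).toLinearMap

theorem cliffordMulₗ_apply (P : SpinStructure m M ι) (W : SpinorModule (m + 1) S) (a : ι) (x : M)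
    (v : TangentSpace (𝓡∂ (m + 1)) x) : cliffordMulₗ P W a x v = cliffordMul P W a x v := rfl

theorem isHypersurfaceClifford_cliffordMulₗ (P : SpinStructure m M ι)
    (W : SpinorModule (m + 1) S) {a : ι} {x : M} (hxa : x ∈ P.U a) :
    IsHypersurfaceClifford W.time (cliffordMulₗ P W a x) := by
  obtain ⟨b, hb⟩ := exists_orthonormalBasis_of_card
    (E := TangentSpace (𝓡∂ (m + 1)) x) (finrank_tangentSpace x)
    (P.orthonormal a x hxa)
  have h := W.isHypersurfaceClifford b
  simp only [hb] at h
  exact h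

theorem cliffordMulₗ_frame (P : SpinStructure m M ι) (W : SpinorModule (m + 1) S) {a : ι} {x : M}
    (hxa : x ∈ P.U a) (i : Fin (m + 1)) :
    cliffordMulₗ P W a x (P.frame a i x) = W.space (Pi.single i 1) := by
  rw [cliffordMulₗ_apply, cliffordMul]
  congr 1
  ext j
  rw [orthonormal_iff_ite.1 (P.orthonormal a x hxa), Pi.single_apply]

theorem IsBoundaryFrame.exists_orthonormalBasis {x : M} (hx : x ∈ (𝓡∂ (m + 1)).boundary M)
    {η : ∀ x : M, TangentSpace (𝓡∂ (m + 1)) x} (hη : IsOutwardNormal η)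
    {e : Fin m → TangentSpace (𝓡∂ (m + 1)) x} (he : IsBoundaryFrame x e) :
    ∃ b : OrthonormalBasis (Fin (m + 1)) ℝ (TangentSpace (𝓡∂ (m + 1)) x),
      ⇑b = Fin.cons (η x) e :=
  exists_orthonormalBasis_cons (E := TangentSpace (𝓡∂ (m + 1)) x) (finrank_tangentSpace x) he.1 (hη.unit x hx)
    fun α => hη.normal x hx _ (he.2 α)

variable {P : SpinStructure m M ι} {W : SpinorModule (m + 1) S}
  {η : ∀ x : M, TangentSpace (𝓡∂ (m + 1)) x} {θ ε : ℝ} {φ : SpinorField P W}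

theorem shift_eq (a : ι) (x : M) (v : TangentSpace (𝓡∂ (m + 1)) x) :
    shift φ a x v =
      (inner ℂ (φ.loc a x) (W.time (cliffordMulₗ P W a x v (φ.loc a x)))).re := rfl

theorem shift_sum (a : ι) (x : M) {κ : Type*} [Fintype κ] (r : κ → ℝ)
    (e : κ → TangentSpace (𝓡∂ (m + 1)) x) :
    shift φ a x (∑ β, r β • e β) = ∑ β, r β * shift φ a x (e β) := by
  simp only [shift_eq, map_sum, map_smul, LinearMap.sum_apply, LinearMap.smul_apply, inner_sum,
    IsHypersurfaceClifford.map_real_smul, inner_smul_right_eq_smul, Complex.re_sum,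
    Complex.smul_re, smul_eq_mul]

/-- Test the bound `abs_shift_le` on `u`, the tangential part of `X` itself: there `X(u) = ‖u‖²`,
and one factor `‖u‖` cancels. -/
theorem sum_sq_shift_le (hη : IsOutwardNormal η) (hε : ε * ε = 1)
    (hQ : ChiralBoundary P W η θ ε φ) {x : M} (hx : x ∈ (𝓡∂ (m + 1)).boundary M) {a : ι}
    (hxa : x ∈ P.U a) {e : Fin m → TangentSpace (𝓡∂ (m + 1)) x} (he : IsBoundaryFrame x e) :
    ∑ α, shift φ a x (e α) ^ 2 ≤ Real.sin θ ^ 2 * lapse φ a x ^ 2 := by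
  set u := ∑ α, shift φ a x (e α) • e α with hu
  have huη : inner ℝ u (η x) = (0 : ℝ) := by
    rw [hu, sum_inner]
    refine Finset.sum_eq_zero fun β _ => ?_
    rw [inner_smul_left, real_inner_comm, hη.normal x hx _ (he.2 β), mul_zero]
  have h := (isHypersurfaceClifford_cliffordMulₗ P W hxa).abs_shift_le (hη.unit x hx)
    (Real.cos_sq_add_sin_sq θ) hε (hQ x hx a hxa) huη
  rw [← shift_eq, hu, shift_sum, ← hu] at h
  have hnorm : ∑ α, shift φ a x (e α) * shift φ a x (e α) = ‖u‖ ^ 2 := by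
    rw [← real_inner_self_eq_norm_sq, hu, he.1.inner_sum]
    simp
  simp only [sq (shift φ a x _)]
  rw [hnorm, abs_of_nonneg (sq_nonneg _)] at h
  change ‖u‖ ^ 2 ≤ |Real.sin θ| * (‖u‖ * lapse φ a x) at h
  rw [hnorm]
  rcases (norm_nonneg u).eq_or_lt with h0 | h0
  · rw [← h0, zero_pow two_ne_zero]
    exact mul_nonneg (sq_nonneg _) (sq_nonneg _)
  · have h1 : ‖u‖ ≤ |Real.sin θ| * lapse φ a x :=
      le_of_mul_le_mul_left (by linarith) h0
    calc ‖u‖ ^ 2 ≤ (|Real.sin θ| * lapse φ a x) ^ 2 := pow_le_pow_left₀ h0.le h1 2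
      _ = Real.sin θ ^ 2 * lapse φ a x ^ 2 := by rw [mul_pow, sq_abs]

variable [IsContMDiffRiemannianBundle (𝓡∂ (m + 1)) ∞ (EuclideanSpace ℝ (Fin (m + 1)))
    (fun x : M => TangentSpace (𝓡∂ (m + 1)) x)]
  {cov : CovariantDerivative (𝓡∂ (m + 1)) (EuclideanSpace ℝ (Fin (m + 1)))
      (fun x : M => TangentSpace (𝓡∂ (m + 1)) x)}
  {p : DataTensor m M} [FiniteDimensional ℂ S]

/-- This is `differentiated_chirality` with `k = ∇_α η`, and with `u` and `q` the tangential and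
normal parts of `p(e_α, ·)`. -/
theorem boundary_spinor_equation (hcov : IsLeviCivita cov) (hη : IsOutwardNormal η)
    (hε : ε * ε = 1) (hpar : IsParallel cov p P W φ) (hQ : ChiralBoundary P W η θ ε φ)
    {x : M} (hx : x ∈ (𝓡∂ (m + 1)).boundary M) {a : ι} (hxa : x ∈ P.U a)
    {e : Fin m → TangentSpace (𝓡∂ (m + 1)) x} (he : IsBoundaryFrame x e) (α : Fin m) :
    cliffordMulₗ P W a x (cov η x (e α) + (ε * Real.cos θ) • ∑ β, p.toFun x (e α) (e β) • e β)
        (cliffordMulₗ P W a x (η x) (φ.loc a x)) +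
      (ε * Real.sin θ * p.toFun x (e α) (η x)) • Complex.I • W.time (φ.loc a x) = 0 := by
  obtain ⟨f, hf⟩ := exists_orthonormalBasis_of_card
    (E := TangentSpace (𝓡∂ (m + 1)) x) (finrank_tangentSpace x)
    (P.orthonormal a x hxa)
  have hfi : ∀ i, f i = P.frame a i x := fun i => congrFun hf i
  obtain ⟨b, hb⟩ := he.exists_orthonormalBasis hx hη
  have hexp : ∀ w, ∑ i, (inner ℝ (P.frame a i x) w : ℝ) • P.frame a i x = w := fun w => by
    simpa only [hfi] using f.sum_repr' w
  have hp : ∑ i, p.toFun x (e α) (P.frame a i x) • P.frame a i x =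
      ∑ β, p.toFun x (e α) (e β) • e β + p.toFun x (e α) (η x) • η x := by
    refine Eq.trans ?_ (add_comm _ _)
    refine Eq.trans ?_ (Fin.sum_univ_succ fun i => p.toFun x (e α) ((Fin.cons (η x) e :
      Fin (m + 1) → TangentSpace (𝓡∂ (m + 1)) x) i) • (Fin.cons (η x) e :
      Fin (m + 1) → TangentSpace (𝓡∂ (m + 1)) x) i)
    rw [← hb]
    have h := sum_apply_smul_eq f b (p.toFun x (e α)).toLinearMap
    simp only [hfi] at h
    exact h
  refine (isHypersurfaceClifford_cliffordMulₗ P W hxa).differentiated_chirality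
    (f := fun i => P.frame a i x) (Γ := fun i => cov (P.frame a i) x (e α))
    (φ' := mvfderiv (𝓡∂ (m + 1)) (φ.loc a) x (e α))
    (hη.unit x hx) hε (hQ x hx a hxa)
    (P.cov_frame_antisymm hcov hxa (e α)) (hexp _) ?_ ?_ ?_
  · rw [sum_inner]
    refine Finset.sum_eq_zero fun β _ => ?_
    rw [inner_smul_left, real_inner_comm, hη.normal x hx _ (he.2 β), mul_zero]
  · have h := hpar a x hxa (e α)
    rw [hypersurfaceConnection, spinConnection] at h
    rw [IsHypersurfaceClifford.spinTerm_apply, ← hp]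
    simp only [map_sum, map_smul, LinearMap.sum_apply, LinearMap.smul_apply]
    exact h
  -- The derivative of the component `⟨f_i, η⟩` splits into a `∇f_i` part, which is the connection
  -- term, and a `∇η` part, which reassembles to `c k φ`.
  · have h := hQ.sum_derivative_eq_zero hcov hη hx hxa (he.2 α)
    simp only [← cliffordMulₗ_frame P W hxa] at h
    have hk : cliffordMulₗ P W a x (cov η x (e α)) (φ.loc a x) =
        ∑ i, (inner ℝ (P.frame a i x) (cov η x (e α)) : ℝ) •
          cliffordMulₗ P W a x (P.frame a i x) (φ.loc a x) := by
      conv_lhs => rw [← hexp (cov η x (e α))]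
      simp
    have hν : cliffordMulₗ P W a x (η x) (mvfderiv (𝓡∂ (m + 1)) (φ.loc a) x (e α)) =
        ∑ i, (inner ℝ (P.frame a i x) (η x) : ℝ) • cliffordMulₗ P W a x (P.frame a i x)
          (mvfderiv (𝓡∂ (m + 1)) (φ.loc a) x (e α)) := by
      conv_lhs => rw [← hexp (η x)]
      simp
    rw [← sub_eq_zero, ← h, hk, hν]
    congr 1
    simp only [map_sum, map_smul, LinearMap.sum_apply, LinearMap.smul_apply, map_add,
      ← Finset.sum_add_distrib, Finset.smul_sum, IsHypersurfaceClifford.map_real_smul]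
    refine Finset.sum_congr rfl fun i _ => ?_
    simp only [LinearMap.add_apply, LinearMap.smul_apply, Module.End.mul_apply, Complex.coe_smul]
    module

/-- The two families of boundary identities, for the coefficients `h + ε cos θ p`. -/
theorem boundary_identities (hcov : IsLeviCivita cov) (hη : IsOutwardNormal η)
    (hε : ε * ε = 1) (hpar : IsParallel cov p P W φ) (hQ : ChiralBoundary P W η θ ε φ)
    {x : M} (hx : x ∈ (𝓡∂ (m + 1)).boundary M) {a : ι} (hxa : x ∈ P.U a)
    {e : Fin m → TangentSpace (𝓡∂ (m + 1)) x} (he : IsBoundaryFrame x e) (α : Fin m) :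
    (∀ γ, (boundaryForm cov η x (e α) (e γ) + ε * Real.cos θ * p.toFun x (e α) (e γ)) *
      lapse φ a x = p.toFun x (e α) (η x) * shift φ a x (e γ)) ∧
    ∑ β, (boundaryForm cov η x (e α) (e β) + ε * Real.cos θ * p.toFun x (e α) (e β)) *
      shift φ a x (e β) = p.toFun x (e α) (η x) * lapse φ a x * Real.sin θ ^ 2 := by
  set A := cov η x (e α) + (ε * Real.cos θ) • ∑ β, p.toFun x (e α) (e β) • e β with hA
  have hηe : ∀ β, inner ℝ (e β) (η x) = (0 : ℝ) := fun β => by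
    rw [real_inner_comm, hη.normal x hx _ (he.2 β)]
  have hAη : inner ℝ A (η x) = (0 : ℝ) := by
    rw [hA, inner_add_left, hη.inner_cov_self hcov hx (he.2 α), inner_smul_left, sum_inner,
      Finset.sum_eq_zero fun β _ => by rw [inner_smul_left, hηe, mul_zero], mul_zero, add_zero]
  have hAe : ∀ γ, (inner ℝ A (e γ) : ℝ) =
      boundaryForm cov η x (e α) (e γ) + ε * Real.cos θ * p.toFun x (e α) (e γ) := fun γ => by
    rw [hA, inner_add_left, inner_smul_left, he.1.inner_left_fintype]
    rfl
  obtain ⟨b, hb⟩ := he.exists_orthonormalBasis hx hη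
  -- `A` has no normal component, since differentiating `|η|² = 1` along `∂M` makes `∇_α η`
  -- tangential.
  have hAsum : A = ∑ β, (inner ℝ A (e β) : ℝ) • e β := by
    have h := b.sum_repr' A
    rw [hb] at h
    have h2 := (Fin.sum_univ_succ fun i => (inner ℝ ((Fin.cons (η x) e :
      Fin (m + 1) → TangentSpace (𝓡∂ (m + 1)) x) i) A : ℝ) • (Fin.cons (η x) e :
      Fin (m + 1) → TangentSpace (𝓡∂ (m + 1)) x) i).symm.trans h
    simp only [Fin.cons_zero, Fin.cons_succ, real_inner_comm A] at h2
    rw [hAη, zero_smul, zero_add] at h2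
    exact h2.symm
  have h := (isHypersurfaceClifford_cliffordMulₗ P W hxa).pairing_identities (hη.unit x hx)
    (Real.cos_sq_add_sin_sq θ) hε (hQ x hx a hxa) hAη
    (boundary_spinor_equation hcov hη hε hpar hQ hx hxa he α)
  refine ⟨fun γ => hAe γ ▸ h.1 (e γ) (hηe γ), ?_⟩
  have h2 : shift φ a x A = p.toFun x (e α) (η x) * lapse φ a x * Real.sin θ ^ 2 := h.2
  rw [← h2]
  conv_rhs => rw [hAsum, shift_sum]
  simp only [hAe]

end Pointwise

end SpinInitialData

end

theorem mainTheorem6 {m : ℕ} {M : Type*} [TopologicalSpace M]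
    [ChartedSpace (EuclideanHalfSpace (m + 1)) M] [IsManifold (𝓡∂ (m + 1)) ∞ M]
    [RiemannianBundle (fun x : M => TangentSpace (𝓡∂ (m + 1)) x)]
    [IsContMDiffRiemannianBundle (𝓡∂ (m + 1)) ∞ (EuclideanSpace ℝ (Fin (m + 1)))
      (fun x : M => TangentSpace (𝓡∂ (m + 1)) x)]
    (cov : CovariantDerivative (𝓡∂ (m + 1)) (EuclideanSpace ℝ (Fin (m + 1)))
      (fun x : M => TangentSpace (𝓡∂ (m + 1)) x))
    (hcov : SpinInitialData.IsLeviCivita cov)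
    (p : SpinInitialData.DataTensor m M)
    {ι : Type*} (P : SpinInitialData.SpinStructure m M ι)
    {S : Type*} [NormedAddCommGroup S] [InnerProductSpace ℂ S] [FiniteDimensional ℂ S]
    (W : SpinInitialData.SpinorModule (m + 1) S)
    (η : ∀ x : M, TangentSpace (𝓡∂ (m + 1)) x) (hη : SpinInitialData.IsOutwardNormal η)
    (θ : ℝ) (hθ : θ ∈ Set.Icc (-(Real.pi / 2)) (Real.pi / 2))
    (ε : ℝ) (hε : ε = 1 ∨ ε = -1)
    (hdec : SpinInitialData.TiltedBoundaryDEC cov p η θ ε)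
    (φ : SpinInitialData.SpinorField P W)
    (hpar : SpinInitialData.IsParallel cov p P W φ)
    (hQ : SpinInitialData.ChiralBoundary P W η θ ε φ)
    (hH : SpinInitialData.BoundaryConstraint cov p P W η θ ε φ) :
    ∀ x ∈ (𝓡∂ (m + 1)).boundary M, ∀ a, x ∈ P.U a →
      ∀ e : Fin m → TangentSpace (𝓡∂ (m + 1)) x, SpinInitialData.IsBoundaryFrame x e →
        (∀ α,
          p.toFun x (e α) (η x) * SpinInitialData.lapse φ a x * Real.sin θ ^ 2 =
              ε * (∑ β, p.toFun x (e α) (e β) * SpinInitialData.shift φ a x (e β)) * Real.cos θ +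
                ∑ β, SpinInitialData.boundaryForm cov η x (e α) (e β) *
                  SpinInitialData.shift φ a x (e β) ∧
          ε * (∑ β, p.toFun x (e α) (e β) * SpinInitialData.shift φ a x (e β)) * Real.cos θ +
                ∑ β, SpinInitialData.boundaryForm cov η x (e α) (e β) *
                  SpinInitialData.shift φ a x (e β) =
            (SpinInitialData.meanCurvature cov η x e +
                ε * Real.cos θ * SpinInitialData.boundaryTrace p x e) *
              SpinInitialData.shift φ a x (e α)) ∧
        ∀ α γ,
          p.toFun x (e α) (η x) * SpinInitialData.shift φ a x (e γ) -
              ε * Real.cos θ * p.toFun x (e α) (e γ) * SpinInitialData.lapse φ a x -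
              SpinInitialData.boundaryForm cov η x (e α) (e γ) *
                SpinInitialData.lapse φ a x = 0 := by
  have hε' : ε * ε = 1 := by rcases hε with rfl | rfl <;> norm_num
  intro x hx a hxa e he
  have hid := SpinInitialData.boundary_identities hcov hη hε' hpar hQ hx hxa he
  have hsplit : ∀ α, ∑ β, (SpinInitialData.boundaryForm cov η x (e α) (e β) +
      ε * Real.cos θ * p.toFun x (e α) (e β)) * SpinInitialData.shift φ a x (e β) =
      ε * (∑ β, p.toFun x (e α) (e β) * SpinInitialData.shift φ a x (e β)) * Real.cos θ +
        ∑ β, SpinInitialData.boundaryForm cov η x (e α) (e β) *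
          SpinInitialData.shift φ a x (e β) := fun α => by
    rw [Finset.mul_sum, Finset.sum_mul, ← Finset.sum_add_distrib]
    exact Finset.sum_congr rfl fun β _ => by ring
  have htr : ∑ β, (SpinInitialData.boundaryForm cov η x (e β) (e β) +
      ε * Real.cos θ * p.toFun x (e β) (e β)) = SpinInitialData.meanCurvature cov η x e +
        ε * Real.cos θ * SpinInitialData.boundaryTrace p x e := by
    rw [Finset.sum_add_distrib, ← Finset.mul_sum]
    rfl
  refine ⟨fun α => ⟨?_, ?_⟩, fun α γ => ?_⟩
  · rw [← hsplit, (hid α).2]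
  · rw [← hsplit, ← htr]
    refine SpinInitialData.sum_mul_eq_trace_mul
      (fun α β => SpinInitialData.boundaryForm cov η x (e α) (e β) +
        ε * Real.cos θ * p.toFun x (e α) (e β))
      (fun α => p.toFun x (e α) (η x)) (fun β => SpinInitialData.shift φ a x (e β))
      (N := SpinInitialData.lapse φ a x) (b := Real.sin θ) (inner_self_nonneg (𝕜 := ℂ))
      (SpinInitialData.sum_sq_shift_le hη hε' hQ hx hxa he) (fun α γ => (hid α).1 γ) ?_ α
    -- The energy condition is written with `p(η, e_α)`, the identities with `p(e_α, η)`.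
    simp only [p.symm x _ (η x)]
    exact htr ▸ hdec x hx e he
  · linear_combination -(hid α).1 γ
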